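/- Theorem 1.2. Let $n\ge 1$ and let $\mathbf X=(X_1,\dots,X_n)$ be a random vector in $\mathbb R^n$ with exchangeable components (its law is invariant under all permutations of the coordinates) and finite fourth moments, $\mathbb E X_i^4<\infty$. Put $$\hat\mu=\frac1n\sum_{i=1}^n X_i,\qquad \hat\sigma=\Big(\frac1n\sum_{i=1}^n (X_i-\hat\mu)^2\Big)^{1/2}.$$ Let $\mathbf Z=(Z_1,\dots,Z_n)$ be a standard Gaussian vector in $\mathbb R^n$ independent of $\mathbf X$, let $\bar Z=\frac1n\sum_{i=1}^n Z_i$, and set $Y_i=\hat\mu+\hat\sigma(Z_i-\bar Z)$ for $i=1,\dots,n$, $\mathbf Y=(Y_1,\dots,Y_n)$. Let $f:\mathbb R^n\to\mathbb R$ be three times continuously differentiable, and for $r=1,2,3$ let $L'_r(f)$ be a finite constant that bounds the absolute values of all $r$th order partial derivatives of $f$, mixed partials included, uniformly on $\mathbb R^n$. For $p = 3,4$ let $m_p=\mathbb E|X_1-\hat\mu|^p$. Then $f(\mathbf X)$ and $f(\mathbf Y)$ are integrable and $$|\mathbb E f(\mathbf X)-\mathbb E f(\mathbf Y)|\le 9.5\,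 m_4^{1/2}\,L'_2(f)\,n^{1/2}+13\, m_3\,L'_3(f)\,n.$$ -/

import Mathlib

open MeasureTheory ProbabilityTheory

namespace Exch

/-- The empirical mean `(1/n) ∑ x_i` of a vector. -/
noncomputable def empMean {n : ℕ} (x : Fin n → ℝ) : ℝ :=
  (1 / (n : ℝ)) * ∑ i, x i

/-- The empirical standard deviation, i.e. the nonnegative root of
`(1/n) ∑ (x_i - mean)^2`. -/
noncomputable def empStd {n : ℕ} (x : Fin n → ℝ) : ℝ :=
  Real.sqrt ((1 / (n : ℝ)) * ∑ i, (x i - empMean x) ^ 2)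

/-- The vector with coordinates `mean(x) + std(x) * (z_i - mean(z))`. -/
noncomputable def surrogate {n : ℕ} (x z : Fin n → ℝ) : Fin n → ℝ :=
  fun i => empMean x + empStd x * (z i - empMean z)

/-- A random vector is exchangeable if its law is invariant under all permutations of
the coordinates. -/
def IsExchangeable {Ω : Type*} [MeasurableSpace Ω] (P : Measure Ω) {n : ℕ}
    (X : Ω → Fin n → ℝ) : Prop :=
  AEMeasurable X P ∧
    ∀ π : Equiv.Perm (Fin n), P.map (fun ω i => X ω (π i)) = P.map X

/-- The law of a standard Gaussian vector: `n` independent `N(0,1)` coordinates. -/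
noncomputable def stdGaussianLaw (n : ℕ) : Measure (Fin n → ℝ) :=
  Measure.pi fun _ => gaussianReal 0 1

/-- `m_p = E |X_1 - mean(X)|^p`. -/
noncomputable def centralMoment {Ω : Type*} [MeasurableSpace Ω] (P : Measure Ω) {n : ℕ}
    [NeZero n] (X : Ω → Fin n → ℝ) (p : ℕ) : ℝ :=
  ∫ ω, |X ω 0 - empMean (X ω)| ^ p ∂P

/-- The partial derivative `∂_i f`. -/
noncomputable def partialDeriv {n : ℕ} (i : Fin n) (f : (Fin n → ℝ) → ℝ) :
    (Fin n → ℝ) → ℝ :=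
  fun x => lineDeriv ℝ f x (Pi.single i 1)

/-- The iterated partial derivative `∂_{i₁} ⋯ ∂_{i_r} f` for a list `[i₁, …, i_r]`. -/
noncomputable def iterPartialDeriv {n : ℕ} (l : List (Fin n)) (f : (Fin n → ℝ) → ℝ) :
    (Fin n → ℝ) → ℝ :=
  l.foldr partialDeriv f

/-- `L` is a uniform bound on all partial derivatives of `f` of order `r`, mixed ones
included. -/
def IsPartialDerivBound {n : ℕ} (r : ℕ) (f : (Fin n → ℝ) → ℝ) (L : ℝ) : Prop :=
  ∀ l : List (Fin n), l.length = r → ∀ x, |iterPartialDeriv l f x| ≤ L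

end Exch

/-! Exchangeability lets `f(X)` be replaced, in expectation, by the average of `f(X ∘ π)` over all
permutations `π`; since `Z` is independent of `X`, the law of `Y` given `X = x` is that of
`surrogate x Z`. So it is enough to compare, for a fixed vector `x`, a uniformly permuted copy of
`x` with a Gaussian vector of the same mean and spread.

Write `a = x - μ` and follow the path `v_θ = μ + cos θ · σ(z - z̄) + sin θ · a∘π` from the surrogate
at `θ = 0` to the permuted vector at `θ = π/2`. Its velocity has a Gaussian part and a permutation
part. Exact Gaussian integration by parts (`integral_centered_mul_partialDeriv`) turns the first
into the second-order operator `∑_{i,j} (∂_i - ∂_j)²`, because the centred Gaussian has covariance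
`I - 11ᵀ/n`. The uniform permutation satisfies the same formula up to an error
(`abs_sum_perm_integration_by_parts_le`), so the leading terms cancel.

That approximate formula is Stein's method of exchangeable pairs. As `∑ a = 0`, the sum `∑ a_{π i}
∂_i g` is a double sum of `(a_{π i} - a_{π j})(∂_i - ∂_j) g`. Composing `π` with the transposition
of `i` and `j` flips the sign of the first factor, and a Taylor expansion along `e_i - e_j` produces
`(s/2)(a_{π i} - a_{π j})² (∂_i - ∂_j)² g` with a third-order remainder. The squared increment is
then replaced by `2q`, `q` being the empirical variance, by relabelling the permutation.

Integrating over `θ` gives `σ² L₂ + 12 ∑ |a_i|³ L₃`. Taking expectations, with `E σ̂² ≤ √m₄`, yields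
more than the stated bound: the `L₂` term needs neither the factor `9.5` nor `√n`. -/

namespace Exch

/-! ### Calculus with partial derivatives and their differences. -/

section PartialDerivatives

variable {n : ℕ} {g h : (Fin n → ℝ) → ℝ} {i j : Fin n} {L : ℝ}

lemma partialDeriv_eq_fderiv (hg : ContDiff ℝ 1 g) (i : Fin n) :
    partialDeriv i g = fun x => fderiv ℝ g x (Pi.single i 1) := by
  funext x
  exact (hg.differentiable one_ne_zero x).lineDeriv_eq_fderiv

lemma contDiff_partialDeriv {k : ℕ} (hg : ContDiff ℝ (k + 1 : ℕ) g) (i : Fin n) :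
    ContDiff ℝ k (partialDeriv i g) := by
  rw [partialDeriv_eq_fderiv (hg.of_le (by exact_mod_cast Nat.le_add_left 1 k))]
  exact (hg.fderiv_right (m := k) (by norm_cast)).clm_apply contDiff_const

lemma fderiv_eq_sum_partialDeriv (hg : ContDiff ℝ 1 g) (x v : Fin n → ℝ) :
    fderiv ℝ g x v = ∑ i, v i * partialDeriv i g x := by
  conv_lhs => rw [pi_eq_sum_univ' v]
  simp [map_sum, partialDeriv_eq_fderiv hg, map_smul]

lemma hasDerivAt_comp_curve (hg : ContDiff ℝ 1 g) {c : ℝ → Fin n → ℝ} {c' : Fin n → ℝ} {t : ℝ}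
    (hc : ∀ i, HasDerivAt (fun t => c t i) (c' i) t) :
    HasDerivAt (fun t => g (c t)) (∑ i, c' i * partialDeriv i g (c t)) t := by
  rw [← fderiv_eq_sum_partialDeriv hg]
  exact (hg.differentiable one_ne_zero (c t)).hasFDerivAt.comp_hasDerivAt t (hasDerivAt_pi.2 hc)

/-- The difference `∂_i g - ∂_j g` of two partial derivatives. -/
noncomputable def diffDeriv (i j : Fin n) (g : (Fin n → ℝ) → ℝ) : (Fin n → ℝ) → ℝ :=
  fun x => partialDeriv i g x - partialDeriv j g x

lemma contDiff_diffDeriv {k : ℕ} (hg : ContDiff ℝ (k + 1 : ℕ) g) (i j : Fin n) :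
    ContDiff ℝ k (diffDeriv i j g) :=
  (contDiff_partialDeriv hg i).sub (contDiff_partialDeriv hg j)

lemma partialDeriv_sub (hg : ContDiff ℝ 1 g) (hh : ContDiff ℝ 1 h) (i : Fin n) :
    partialDeriv i (fun x => g x - h x) = fun x => partialDeriv i g x - partialDeriv i h x := by
  rw [partialDeriv_eq_fderiv (hg.sub hh), partialDeriv_eq_fderiv hg, partialDeriv_eq_fderiv hh]
  funext x
  rw [fderiv_fun_sub (hg.differentiable one_ne_zero x) (hh.differentiable one_ne_zero x)]
  rfl

lemma contDiff_iterPartialDeriv {k : ℕ} (l : List (Fin n)) (hg : ContDiff ℝ (k + l.length : ℕ) g) :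
    ContDiff ℝ k (iterPartialDeriv l g) := by
  induction l generalizing k with
  | nil => simpa [iterPartialDeriv] using hg
  | cons a l ih =>
    refine contDiff_partialDeriv (ih ?_) a
    convert hg using 2
    simp only [List.length_cons]; ring

lemma iterPartialDeriv_sub (l : List (Fin n)) (hg : ContDiff ℝ l.length g)
    (hh : ContDiff ℝ l.length h) :
    iterPartialDeriv l (fun x => g x - h x) =
      fun x => iterPartialDeriv l g x - iterPartialDeriv l h x := by
  induction l with
  | nil => rfl
  | cons a l ih =>
    have e : (a :: l).length = 1 + l.length := by simp [add_comm]
    rw [e] at hg hh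
    have hle : ((l.length : ℕ) : WithTop ℕ∞) ≤ ((1 + l.length : ℕ) : WithTop ℕ∞) := by
      exact_mod_cast Nat.le_add_left _ _
    change partialDeriv a (iterPartialDeriv l _) = _
    rw [ih (hg.of_le hle) (hh.of_le hle),
      partialDeriv_sub (by simpa using contDiff_iterPartialDeriv l hg)
        (by simpa using contDiff_iterPartialDeriv l hh)]
    rfl

/-- In `foldr` the last list entry acts first, so differentiating `g` beforehand appends `i` at the
end of the list. -/
lemma IsPartialDerivBound.partialDeriv {r : ℕ} (hL : IsPartialDerivBound (r + 1) g L) (i : Fin n) :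
    IsPartialDerivBound r (partialDeriv i g) L := by
  intro l hl x
  have := hL (l ++ [i]) (by simp [hl]) x
  simpa [iterPartialDeriv, List.foldr_append] using this

/-- Each `∂_i - ∂_j` trades one order of differentiation for a factor 2; two uses give the `4` and
three the `8` in later constants. -/
lemma IsPartialDerivBound.diffDeriv {r : ℕ} (hg : ContDiff ℝ (r + 1 : ℕ) g)
    (hL : IsPartialDerivBound (r + 1) g L) (i j : Fin n) :
    IsPartialDerivBound r (diffDeriv i j g) (2 * L) := by
  intro l hl x
  have h1 := hL.partialDeriv i l hl x
  have h2 := hL.partialDeriv j l hl x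
  unfold Exch.diffDeriv
  rw [iterPartialDeriv_sub l (by rw [hl]; exact contDiff_partialDeriv hg i)
    (by rw [hl]; exact contDiff_partialDeriv hg j)]
  have := abs_sub (iterPartialDeriv l (Exch.partialDeriv i g) x)
    (iterPartialDeriv l (Exch.partialDeriv j g) x)
  linarith

lemma IsPartialDerivBound.abs_le (hL : IsPartialDerivBound 0 g L) (x : Fin n → ℝ) : |g x| ≤ L :=
  hL [] rfl x

lemma IsPartialDerivBound.abs_partialDeriv_le (hL : IsPartialDerivBound 1 g L) (i : Fin n)
    (x : Fin n → ℝ) : |Exch.partialDeriv i g x| ≤ L :=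
  (hL.partialDeriv i).abs_le x

lemma IsPartialDerivBound.nonneg [NeZero n] {r : ℕ} (hL : IsPartialDerivBound r g L) : 0 ≤ L :=
  (abs_nonneg _).trans (hL (List.replicate r 0) (by simp) 0)

/-- A bound on the first partial derivatives is a Lipschitz constant for the `ℓ¹` norm. -/
lemma IsPartialDerivBound.abs_sub_le (hg : ContDiff ℝ 1 g) (hL : IsPartialDerivBound 1 g L)
    (x y : Fin n → ℝ) : |g x - g y| ≤ L * ∑ i, |x i - y i| := by
  have hd : ∀ t : ℝ, HasDerivAt (fun t : ℝ => g (fun i => y i + t * (x i - y i)))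
      (∑ i, (x i - y i) * Exch.partialDeriv i g (fun i => y i + t * (x i - y i))) t := fun t =>
    hasDerivAt_comp_curve hg (c := fun t i => y i + t * (x i - y i)) fun i => by
      simpa using ((hasDerivAt_id t).mul_const (x i - y i)).const_add (y i)
  have := norm_image_sub_le_of_norm_deriv_le_segment_01' (C := L * ∑ i, |x i - y i|)
    (fun t _ => (hd t).hasDerivWithinAt) (fun t _ => by
      refine (norm_sum_le _ _).trans ?_
      rw [Finset.mul_sum]
      refine Finset.sum_le_sum fun i _ => ?_
      rw [norm_mul, mul_comm]
      exact mul_le_mul_of_nonneg_right (hL.abs_partialDeriv_le i _) (abs_nonneg _))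
  simpa using this

/-- Second-order Taylor bound in the direction `e_i - e_j`. -/
lemma abs_taylor_diffDeriv_le (hg : ContDiff ℝ 2 g) {M : ℝ} (hij : i ≠ j)
    (hM : ∀ x, |diffDeriv i j (diffDeriv i j g) x| ≤ M) (x y : Fin n → ℝ) (d : ℝ)
    (hi : y i = x i + d) (hj : y j = x j - d) (hne : ∀ m, m ≠ i → m ≠ j → y m = x m) :
    |g y - g x - d * diffDeriv i j g x| ≤ M * d ^ 2 / 2 := by
  -- The increment `y - x = d (e_i - e_j)`; along it, one derivative in `t` is `d` times `diffDeriv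
  -- i j`.
  set u : Fin n → ℝ := fun m => if m = i then d else if m = j then -d else 0 with hu
  have hy : y = fun m => x m + 1 * u m := by
    funext m
    by_cases h1 : m = i
    · subst h1; simp [hu, hi]
    · by_cases h2 : m = j
      · subst h2; simp [hu, h1, hj, sub_eq_add_neg]
      · simp [hu, h1, h2, hne m h1 h2]
  have hd : ∀ {k : (Fin n → ℝ) → ℝ}, ContDiff ℝ 1 k → ∀ t : ℝ,
      HasDerivAt (fun t : ℝ => k (fun m => x m + t * u m))
        (d * diffDeriv i j k (fun m => x m + t * u m)) t := by
    intro k hk t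
    have := hasDerivAt_comp_curve hk (c := fun t m => x m + t * u m) (c' := u) (t := t) fun m => by
      simpa using ((hasDerivAt_id t).mul_const (u m)).const_add (x m)
    convert this using 1
    rw [Finset.sum_eq_add i j hij]
    · simp [hu, hij.symm, diffDeriv]; ring
    · intro m _ hm; simp [hu, hm.1, hm.2]
    · simp
    · simp
  have hg1 : ContDiff ℝ 1 g := hg.of_le (by norm_num)
  have hDg : ContDiff ℝ 1 (diffDeriv i j g) := by
    have := contDiff_diffDeriv (k := 1) (by exact_mod_cast hg) i j
    exact_mod_cast this
  -- The mean value inequality is applied twice: here to the derivative, and then to `g` itself with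
  -- `M d² t` as the bound on the derivative's deviation.
  have hfirst : ∀ t ∈ Set.Icc (0 : ℝ) 1,
      ‖d * diffDeriv i j g (fun m => x m + t * u m) - d * diffDeriv i j g x‖ ≤ M * d ^ 2 * t := by
    intro t ht
    have := norm_image_sub_le_of_norm_deriv_le_segment'
      (f := fun t => d * diffDeriv i j g (fun m => x m + t * u m)) (C := M * d ^ 2)
      (fun t _ => ((hd hDg t).const_mul d).hasDerivWithinAt) (fun t _ => by
        rw [norm_mul, norm_mul, Real.norm_eq_abs, Real.norm_eq_abs, ← mul_assoc, abs_mul_abs_self,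
          ← sq, mul_comm]
        exact mul_le_mul_of_nonneg_right (hM _) (sq_nonneg d)) t ht
    simpa using this
  have := image_norm_le_of_norm_deriv_right_le_deriv_boundary (a := 0) (b := 1)
    (f := fun t : ℝ => g (fun m => x m + t * u m) - g x - t * (d * diffDeriv i j g x))
    (f' := fun t => d * diffDeriv i j g (fun m => x m + t * u m) - d * diffDeriv i j g x)
    (B := fun t => M * d ^ 2 * (t ^ 2 / 2)) (B' := fun t => M * d ^ 2 * t)
    (fun t _ => ((((hd hg1 t).sub_const (g x)).sub
      (by simpa using (hasDerivAt_id t).mul_const (d * diffDeriv i j g x)))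
        |>.continuousAt.continuousWithinAt))
    (fun t _ => (((hd hg1 t).sub_const (g x)).sub
      (by simpa using (hasDerivAt_id t).mul_const (d * diffDeriv i j g x))).hasDerivWithinAt)
    (by simp) (fun t => by
      have h2 : HasDerivAt (fun t : ℝ => t ^ 2 / 2) t t := by
        simpa using (hasDerivAt_pow 2 t).div_const 2
      exact h2.const_mul (M * d ^ 2))
    (fun t ht => hfirst t (Set.Ico_subset_Icc_self ht)) (Set.right_mem_Icc.2 zero_le_one)
  rw [hy]
  simp only [one_mul, one_pow, Real.norm_eq_abs] at this ⊢
  linarith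

end PartialDerivatives

/-! ### Stein's identity for Gaussian vectors. -/

section GaussianIntegrationByParts

lemma hasDerivAt_gaussianPDFReal_std (x : ℝ) :
    HasDerivAt (gaussianPDFReal 0 1) (-x * gaussianPDFReal 0 1 x) x := by
  have h : HasDerivAt (fun x : ℝ => -(x - 0) ^ 2 / (2 * (1 : NNReal))) (-x) x := by
    have := (hasDerivAt_pow 2 x).neg.div_const 2
    have e : -(2 * x) / 2 = -x := by ring
    simpa [e] using this
  have := h.exp.const_mul (√(2 * Real.pi * (1 : NNReal)))⁻¹
  rw [gaussianPDFReal_def]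
  refine this.congr_deriv ?_
  beta_reduce
  ring

lemma integrable_gaussianReal_iff {h : ℝ → ℝ} :
    Integrable h (gaussianReal 0 1) ↔ Integrable (fun x => gaussianPDFReal 0 1 x * h x) := by
  rw [gaussianReal_of_var_ne_zero _ one_ne_zero,
    integrable_withDensity_iff_integrable_smul' (measurable_gaussianPDF 0 1)
      (Filter.Eventually.of_forall fun _ => gaussianPDF_lt_top)]
  simp [toReal_gaussianPDF]

lemma integrable_id_gaussianReal : Integrable (fun x : ℝ => x) (gaussianReal 0 1) :=
  (memLp_id_gaussianReal 1).integrable (by simp)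

/-- Stein's identity for the standard normal law. -/
lemma integral_mul_gaussianReal {h h' : ℝ → ℝ} (hh : ∀ x, HasDerivAt h (h' x) x) {C C' : ℝ}
    (hC : ∀ x, |h x| ≤ C) (hC' : ∀ x, |h' x| ≤ C') (hm : Measurable h') :
    ∫ x, x * h x ∂gaussianReal 0 1 = ∫ x, h' x ∂gaussianReal 0 1 := by
  have hcont : Continuous h := continuous_iff_continuousAt.2 fun x => (hh x).continuousAt
  have i1 : Integrable h (gaussianReal 0 1) :=
    Integrable.of_bound hcont.aestronglyMeasurable C (Filter.Eventually.of_forall hC)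
  have i2 : Integrable h' (gaussianReal 0 1) :=
    Integrable.of_bound hm.aestronglyMeasurable C' (Filter.Eventually.of_forall hC')
  have i3 : Integrable (fun x => x * h x) (gaussianReal 0 1) :=
    integrable_id_gaussianReal.mul_bdd (c := C) hcont.aestronglyMeasurable (Filter.Eventually.of_forall hC)
  rw [integral_gaussianReal_eq_integral_smul one_ne_zero,
    integral_gaussianReal_eq_integral_smul one_ne_zero]
  rw [integrable_gaussianReal_iff] at i1 i2 i3
  -- Integration by parts against the density `φ`, with `φ' = -xφ`; there are no boundary terms
  -- since all three products are integrable over the line.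
  have key := integral_mul_deriv_eq_deriv_mul_of_integrable (u := gaussianPDFReal 0 1) (v := h)
    (fun x _ => hasDerivAt_gaussianPDFReal_std x) (fun x _ => hh x) i2
    (by
      refine i3.neg.congr (Filter.Eventually.of_forall fun x => ?_)
      simp; ring) i1
  simp only [smul_eq_mul]
  rw [key, ← integral_neg]
  exact integral_congr_ae (Filter.Eventually.of_forall fun x => by ring)

instance (n : ℕ) : IsProbabilityMeasure (stdGaussianLaw n) := by
  unfold stdGaussianLaw; infer_instance

lemma measurePreserving_eval_stdGaussianLaw {n : ℕ} (k : Fin n) :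
    MeasurePreserving (fun z : Fin n → ℝ => z k) (stdGaussianLaw n) (gaussianReal 0 1) :=
  measurePreserving_eval (fun _ : Fin n => gaussianReal 0 1) k

lemma memLp_eval_stdGaussianLaw {n : ℕ} (k : Fin n) (p : NNReal) :
    MemLp (fun z : Fin n → ℝ => z k) p (stdGaussianLaw n) :=
  (memLp_id_gaussianReal p).comp_measurePreserving (measurePreserving_eval_stdGaussianLaw k)

lemma integrable_eval_stdGaussianLaw {n : ℕ} (k : Fin n) :
    Integrable (fun z : Fin n → ℝ => z k) (stdGaussianLaw n) :=
  (memLp_eval_stdGaussianLaw k 1).integrable (by simp)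

/-- Gaussian integration by parts in one coordinate of a standard Gaussian vector. -/
lemma integral_eval_mul_stdGaussianLaw {n : ℕ} {u : (Fin n → ℝ) → ℝ} (hu : ContDiff ℝ 1 u)
    (k : Fin n) {C C' : ℝ} (hC : ∀ z, |u z| ≤ C) (hC' : ∀ z, |partialDeriv k u z| ≤ C') :
    ∫ z, z k * u z ∂stdGaussianLaw n = ∫ z, partialDeriv k u z ∂stdGaussianLaw n := by
  obtain _ | m := n
  · exact k.elim0
  have hmeas : Measurable (partialDeriv k u) :=
    (contDiff_partialDeriv (k := 0) (by exact_mod_cast hu) k).continuous.measurable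
  have hu_meas : Measurable u := hu.continuous.measurable
  -- Coordinate `k` is split off, so that Fubini leaves the one-dimensional identity with the other
  -- coordinates `y` frozen.
  have mp := (measurePreserving_piFinSuccAbove (fun _ : Fin (m + 1) => gaussianReal 0 1) k).symm
  have i1 : Integrable (fun z : Fin (m + 1) → ℝ => z k * u z) (stdGaussianLaw (m + 1)) :=
    (integrable_eval_stdGaussianLaw k).mul_bdd (c := C) hu_meas.aestronglyMeasurable
      (Filter.Eventually.of_forall hC)
  have i2 : Integrable (partialDeriv k u) (stdGaussianLaw (m + 1)) :=
    Integrable.of_bound hmeas.aestronglyMeasurable C' (Filter.Eventually.of_forall hC')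
  unfold stdGaussianLaw at *
  rw [← mp.integral_comp', ← mp.integral_comp']
  have j1 := mp.integrable_comp_of_integrable i1
  have j2 := mp.integrable_comp_of_integrable i2
  simp only [Function.comp_def] at j1 j2
  rw [integral_prod_symm _ j1, integral_prod_symm _ j2]
  refine integral_congr_ae (Filter.Eventually.of_forall fun y => ?_)
  have hd : ∀ x, HasDerivAt (fun x => u (k.insertNth x y))
      (partialDeriv k u (k.insertNth x y)) x := by
    intro x
    have := hasDerivAt_comp_curve hu (c := fun x => k.insertNth x y) (c' := Pi.single k 1) (t := x)
      (fun i => by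
        induction i using Fin.succAboveCases k with
        | x => simpa using hasDerivAt_id' x
        | p j => simpa using hasDerivAt_const x (y j))
    simpa [Pi.single_apply] using this
  have hins : Measurable fun x : ℝ => (k.insertNth x y : Fin (m + 1) → ℝ) := by
    refine measurable_pi_iff.2 fun i => ?_
    induction i using Fin.succAboveCases k with
    | x => simpa using measurable_id'
    | p j => simp
  have := integral_mul_gaussianReal hd (fun x => hC _) (fun x => hC' _) (hmeas.comp hins)
  have he : ∀ x, (MeasurableEquiv.piFinSuccAbove (fun _ : Fin (m + 1) => ℝ) k).symm (x, y) =
      k.insertNth x y := fun _ => rfl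
  simpa [he] using this

end GaussianIntegrationByParts

/-! ### Sums over pairs of indices and over permutations. -/

section Permutations

open Equiv

variable {n : ℕ}

/-- The cross terms `a i * F j` vanish on summing over `i`, because `a` is centred. This brings in
the pairs to which transpositions apply. -/
lemma sum_sub_mul_sub (a F : Fin n → ℝ) (ha : ∑ i, a i = 0) :
    ∑ i, ∑ j, (a i - a j) * (F i - F j) = 2 * n * ∑ i, a i * F i := by
  have : ∀ i j, (a i - a j) * (F i - F j) = a i * F i - a i * F j - a j * F i + a j * F j :=
    fun i j => by ring
  simp only [this, Finset.sum_add_distrib, Finset.sum_sub_distrib, ← Finset.mul_sum,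
    ← Finset.sum_mul, ha, Finset.sum_const, Finset.card_univ, Fintype.card_fin, nsmul_eq_mul,
    mul_left_comm (a _)]
  ring

lemma sum_sub_sq (a : Fin n → ℝ) (ha : ∑ i, a i = 0) :
    ∑ i, ∑ j, (a i - a j) ^ 2 = 2 * n * ∑ i, a i ^ 2 := by
  simpa [sq] using sum_sub_mul_sub a a ha

/-- Convexity alone would give the constant 8. The pointwise bound in the proof keeps mixed terms
linear in `a i` or in `a j`; these cancel by centring, which leaves 4. Its slack contains `(|a i| +
|a j|)(|a i| - |a j|)²`. -/
lemma sum_abs_sub_pow_three_le (a : Fin n → ℝ) (ha : ∑ i, a i = 0) :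
    ∑ i, ∑ j, |a i - a j| ^ 3 ≤ 4 * n * ∑ i, |a i| ^ 3 := by
  have h : ∀ i j, |a i - a j| ^ 3 ≤
      2 * |a i| ^ 3 + 2 * |a j| ^ 3 - 2 * (a i * |a i|) * a j - 2 * a i * (a j * |a j|) := by
    intro i j
    have h1 : |a i - a j| ^ 3 = (a i - a j) ^ 2 * |a i - a j| := by
      rw [pow_succ, sq_abs]
    have h2 : (a i - a j) ^ 2 * |a i - a j| ≤ (a i - a j) ^ 2 * (|a i| + |a j|) :=
      mul_le_mul_of_nonneg_left (abs_sub _ _) (sq_nonneg _)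
    have h3 : 0 ≤ (|a i| + |a j|) * (|a i| - |a j|) ^ 2 := by positivity
    have h4 := sq_abs (a i)
    have h5 := sq_abs (a j)
    rw [h1]
    refine h2.trans (le_of_sub_nonneg ?_)
    refine h3.trans (le_of_eq ?_)
    linear_combination -(|a i| + |a j|) * h4 - (|a i| + |a j|) * h5
  refine (Finset.sum_le_sum fun i _ => Finset.sum_le_sum fun j _ => h i j).trans (le_of_eq ?_)
  simp only [Finset.sum_add_distrib, Finset.sum_sub_distrib, ← Finset.mul_sum,
    ← Finset.sum_mul, ha, Finset.sum_const, Finset.card_univ, Fintype.card_fin, nsmul_eq_mul]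
  ring

lemma sum_perm_mul_right (ρ : Perm (Fin n)) (F : Perm (Fin n) → ℝ) :
    ∑ π, F (π * ρ) = ∑ π, F π :=
  Equiv.sum_comp (Equiv.mulRight ρ) F

lemma sum_perm_apply_eq (F : Fin n → ℝ) (i j : Fin n) :
    ∑ π : Perm (Fin n), F (π i) = ∑ π : Perm (Fin n), F (π j) := by
  rw [← sum_perm_mul_right (swap i j) fun π => F (π j)]
  simp

lemma card_mul_sum_perm_apply (F : Fin n → ℝ) (i : Fin n) :
    n * ∑ π : Perm (Fin n), F (π i) = Fintype.card (Perm (Fin n)) * ∑ m, F m := by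
  have h : ∑ m : Fin n, ∑ π : Perm (Fin n), F (π m) = n * ∑ π : Perm (Fin n), F (π i) := by
    rw [Finset.sum_congr rfl fun m _ => sum_perm_apply_eq F m i]
    simp
  rw [← h, Finset.sum_comm, Finset.sum_congr rfl fun π _ => Equiv.sum_comp π F]
  simp

/-- Expanding and using Young's inequality reduces everything to cubes of single coordinates, whose
sums over permutations do not depend on the coordinate; the weights are `8/3 + 8/3 + 4/3 + 4/3 = 8`.
The indices may coincide. -/
lemma sum_perm_sub_sq_mul_abs_sub_le (a : Fin n → ℝ) (i k l p q : Fin n) :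
    ∑ π : Perm (Fin n), (a (π k) - a (π l)) ^ 2 * |a (π p) - a (π q)| ≤
      8 * ∑ π : Perm (Fin n), |a (π i)| ^ 3 := by
  have young : ∀ x y : ℝ, x ^ 2 * |y| ≤ 2 / 3 * |x| ^ 3 + 1 / 3 * |y| ^ 3 := by
    intro x y
    rw [← sq_abs x]
    have hx := abs_nonneg x
    have hy := abs_nonneg y
    nlinarith [mul_nonneg (by positivity : 0 ≤ 2 * |x| + |y|) (sq_nonneg (|x| - |y|))]
  have h : ∀ π : Perm (Fin n), (a (π k) - a (π l)) ^ 2 * |a (π p) - a (π q)| ≤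
      8 / 3 * |a (π k)| ^ 3 + 8 / 3 * |a (π l)| ^ 3 + 4 / 3 * |a (π p)| ^ 3
        + 4 / 3 * |a (π q)| ^ 3 := by
    intro π
    have h1 : (a (π k) - a (π l)) ^ 2 ≤ 2 * a (π k) ^ 2 + 2 * a (π l) ^ 2 := by
      nlinarith [sq_nonneg (a (π k) + a (π l))]
    have h2 := abs_sub (a (π p)) (a (π q))
    have h3 := mul_le_mul h1 h2 (abs_nonneg _) (by positivity)
    linarith [young (a (π k)) (a (π p)), young (a (π k)) (a (π q)), young (a (π l)) (a (π p)),
      young (a (π l)) (a (π q))]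
  refine (Finset.sum_le_sum fun π _ => h π).trans (le_of_eq ?_)
  simp only [Finset.sum_add_distrib, ← Finset.mul_sum]
  rw [sum_perm_apply_eq (fun m => |a m| ^ 3) k i, sum_perm_apply_eq (fun m => |a m| ^ 3) l i,
    sum_perm_apply_eq (fun m => |a m| ^ 3) p i, sum_perm_apply_eq (fun m => |a m| ^ 3) q i]
  ring

lemma sum_abs_swap_sub (b : Fin n → ℝ) (i k : Fin n) :
    ∑ m, |b (swap i k m) - b m| ≤ 2 * |b i - b k| := by
  by_cases hik : i = k
  · subst hik; simp
  · rw [Finset.sum_eq_add i k hik]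
    · rw [swap_apply_left, swap_apply_right, abs_sub_comm (b k)]; linarith
    · intro m _ hm; rw [swap_apply_of_ne_of_ne hm.1 hm.2]; simp
    · simp
    · simp

/-- A permutation moving `i ↦ k` and `j ↦ l` changes a vector by a controlled `ℓ¹` amount. -/
lemma exists_perm_sum_perm_le (a : Fin n → ℝ) {i j k l : Fin n} (hij : i ≠ j) (hkl : k ≠ l) :
    ∃ ρ : Perm (Fin n), ρ i = k ∧ ρ j = l ∧
      ∑ π : Perm (Fin n), (a (π k) - a (π l)) ^ 2 * ∑ m, |a ((π * ρ) m) - a (π m)| ≤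
        32 * ∑ π : Perm (Fin n), |a (π i)| ^ 3 := by
  have hl : i ≠ swap i k l := by
    intro h
    have := congrArg (swap i k) h
    rw [swap_apply_left, swap_apply_self] at this
    exact hkl this
  -- The inner transposition fixes `i` and sends `j` to the preimage of `l` under `swap i k`. This
  -- works however the pairs overlap, and each of the two transpositions costs `2 · 8` in the final
  -- bound.
  refine ⟨swap i k * swap j (swap i k l), ?_, ?_, ?_⟩
  · simp [swap_apply_of_ne_of_ne hij hl]
  · simp
  have h : ∀ π : Perm (Fin n),
      (a (π k) - a (π l)) ^ 2 *
        ∑ m, |a ((π * (swap i k * swap j (swap i k l))) m) - a (π m)| ≤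
      2 * ((a (π k) - a (π l)) ^ 2 * |a (π (swap i k j)) - a (π l)|) +
      2 * ((a (π k) - a (π l)) ^ 2 * |a (π i) - a (π k)|) := by
    intro π
    have h1 := sum_abs_swap_sub (fun m => a (π (swap i k m))) j (swap i k l)
    have h2 := sum_abs_swap_sub (fun m => a (π m)) i k
    have h3 : ∑ m, |a ((π * (swap i k * swap j (swap i k l))) m) - a (π m)| ≤
        ∑ m, |a (π (swap i k (swap j (swap i k l) m))) - a (π (swap i k m))| +
        ∑ m, |a (π (swap i k m)) - a (π m)| := by
      rw [← Finset.sum_add_distrib]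
      exact Finset.sum_le_sum fun m _ => abs_sub_le _ _ _
    rw [swap_apply_self] at h1
    have := mul_le_mul_of_nonneg_left (h3.trans (add_le_add h1 h2))
      (sq_nonneg (a (π k) - a (π l)))
    linarith
  refine (Finset.sum_le_sum fun π _ => h π).trans ?_
  rw [Finset.sum_add_distrib, ← Finset.mul_sum, ← Finset.mul_sum]
  linarith [sum_perm_sub_sq_mul_abs_sub_le a i k l (swap i k j) l,
    sum_perm_sub_sq_mul_abs_sub_le a i k l i k]

end Permutations

/-! ### Approximate integration by parts for a uniform permutation. -/

section PermutationAverages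

open Equiv

variable {n : ℕ}

lemma sum_offDiag_eq (F : Fin n → Fin n → ℝ) (hF : ∀ i, F i i = 0) :
    ∑ p ∈ (Finset.univ : Finset (Fin n)).offDiag, F p.1 p.2 = ∑ i, ∑ j, F i j := by
  rw [← Fintype.sum_prod_type (f := fun p : Fin n × Fin n => F p.1 p.2)]
  refine Finset.sum_subset (Finset.subset_univ _) fun p _ hp => ?_
  have : p.1 = p.2 := by simpa using hp
  rw [this, hF]

lemma cast_card_offDiag :
    (((Finset.univ : Finset (Fin n)).offDiag.card : ℕ) : ℝ) = (n : ℝ) * n - n := by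
  rw [Finset.offDiag_card, Nat.cast_sub (by simpa using Nat.le_mul_self n)]
  simp

/-- The exchangeable-pair step: antisymmetry under a transposition followed by Taylor expansion. -/
lemma abs_sum_perm_sub_mul_diffDeriv_le [NeZero n] {g : (Fin n → ℝ) → ℝ} (hg : ContDiff ℝ 3 g)
    {L₃ : ℝ} (hL₃ : IsPartialDerivBound 3 g L₃) (a w : Fin n → ℝ) (s : ℝ) (i j : Fin n) :
    |∑ π : Perm (Fin n), (a (π i) - a (π j)) * diffDeriv i j g (fun m => w m + s * a (π m)) -
      s / 2 * ∑ π : Perm (Fin n), (a (π i) - a (π j)) ^ 2 *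
        diffDeriv i j (diffDeriv i j g) (fun m => w m + s * a (π m))| ≤
      2 * L₃ * s ^ 2 * ∑ π : Perm (Fin n), |a (π i) - a (π j)| ^ 3 := by
  by_cases hij : i = j
  · subst hij; simp
  set v : Perm (Fin n) → Fin n → ℝ := fun π m => w m + s * a (π m) with hv
  set u : Perm (Fin n) → ℝ := fun π => diffDeriv i j g (v π) with hu
  set D : Perm (Fin n) → ℝ := fun π => diffDeriv i j (diffDeriv i j g) (v π) with hD
  have hg2 : ContDiff ℝ 2 (diffDeriv i j g) := contDiff_diffDeriv (k := 2) (by exact_mod_cast hg) i j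
  have hb : ∀ x, |diffDeriv i j (diffDeriv i j (diffDeriv i j g)) x| ≤ 8 * L₃ := by
    intro x
    have h1 := hL₃.diffDeriv (by exact_mod_cast hg) i j
    have h2 := h1.diffDeriv (by exact_mod_cast hg2) i j
    have hg1 := contDiff_diffDeriv (k := 1) (by exact_mod_cast hg2) i j
    have h3 := (h2.diffDeriv (r := 0) (by exact_mod_cast hg1) i j).abs_le x
    linarith
  -- Swapping `i` and `j` moves `v π` by `-s (a (π i) - a (π j))` in the direction `e_i - e_j`.
  have hT : ∀ π, |u (π * swap i j) - u π - (-(s * (a (π i) - a (π j)))) * D π| ≤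
      8 * L₃ * (-(s * (a (π i) - a (π j)))) ^ 2 / 2 := by
    intro π
    refine abs_taylor_diffDeriv_le hg2 hij hb _ _ _ ?_ ?_ ?_
    · simp [hv]; ring
    · simp [hv]; ring
    · intro m h1 h2
      simp [hv, swap_apply_of_ne_of_ne h1 h2]
  -- Reindexing by the transposition reverses the sign of the increment; averaging both forms gives
  -- the factor `1/2` in `hmain`.
  have hanti : ∑ π : Perm (Fin n), (a (π i) - a (π j)) * u π =
      -∑ π : Perm (Fin n), (a (π i) - a (π j)) * u (π * swap i j) := by
    rw [← sum_perm_mul_right (swap i j), ← Finset.sum_neg_distrib]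
    refine Finset.sum_congr rfl fun π _ => ?_
    simp; ring
  have hmain : ∑ π : Perm (Fin n), (a (π i) - a (π j)) * u π -
      s / 2 * ∑ π : Perm (Fin n), (a (π i) - a (π j)) ^ 2 * D π =
      -(1 / 2) * ∑ π : Perm (Fin n), (a (π i) - a (π j)) *
        (u (π * swap i j) - u π - (-(s * (a (π i) - a (π j)))) * D π) := by
    have : ∀ π : Perm (Fin n), (a (π i) - a (π j)) *
        (u (π * swap i j) - u π - (-(s * (a (π i) - a (π j)))) * D π) =
        (a (π i) - a (π j)) * u (π * swap i j) - (a (π i) - a (π j)) * u π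
          + s * ((a (π i) - a (π j)) ^ 2 * D π) := fun π => by ring
    rw [Finset.sum_congr rfl fun π _ => this π, Finset.sum_add_distrib, Finset.sum_sub_distrib,
      ← Finset.mul_sum]
    linarith
  rw [hmain, abs_mul, Finset.mul_sum]
  have h2 : |∑ π : Perm (Fin n), (a (π i) - a (π j)) *
      (u (π * swap i j) - u π - (-(s * (a (π i) - a (π j)))) * D π)| ≤
      ∑ π : Perm (Fin n), 2 * (2 * L₃ * s ^ 2 * |a (π i) - a (π j)| ^ 3) := by
    refine (Finset.abs_sum_le_sum_abs _ _).trans (Finset.sum_le_sum fun π _ => ?_)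
    rw [abs_mul]
    refine (mul_le_mul_of_nonneg_left (hT π) (abs_nonneg _)).trans (le_of_eq ?_)
    have := sq_abs (a (π i) - a (π j))
    rw [neg_sq, mul_pow, ← this]
    ring
  rw [← Finset.mul_sum] at h2
  rw [show |(-(1 / 2) : ℝ)| = 1 / 2 by norm_num [abs_of_pos]]
  linarith

/-- Replacing `(a_i - a_j)²` by its average over all pairs, by relabelling the permutation. -/
lemma mul_abs_sum_perm_sq_sub_mul_le {a : Fin n → ℝ} (ha : ∑ i, a i = 0) {q : ℝ} (hq0 : 0 ≤ q)
    (hq : n * q = ∑ i, a i ^ 2) {G : (Fin n → ℝ) → ℝ} {M K : ℝ} (hM : ∀ x, |G x| ≤ M)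
    (hK0 : 0 ≤ K) (hK : ∀ x y, |G x - G y| ≤ K * ∑ m, |x m - y m|) (w : Fin n → ℝ) {s : ℝ}
    (hs : 0 ≤ s) {i j : Fin n} (hij : i ≠ j) (m₀ : Fin n) :
    ((n : ℝ) * n - n) * |∑ π : Perm (Fin n),
        ((a (π i) - a (π j)) ^ 2 - 2 * q) * G (fun m => w m + s * a (π m))| ≤
      ((n : ℝ) * n - n) * (32 * K * s * ∑ π : Perm (Fin n), |a (π m₀)| ^ 3) +
        2 * n * q * M * Fintype.card (Perm (Fin n)) := by
  set v : Perm (Fin n) → Fin n → ℝ := fun π m => w m + s * a (π m) with hv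
  set S := ∑ π : Perm (Fin n), (a (π i) - a (π j)) ^ 2 * G (v π) with hS
  set T := ∑ π : Perm (Fin n), |a (π m₀)| ^ 3 with hT
  -- Reindexing by `ρ` moves the squared increment to the pair `p` at the price of evaluating `G` at
  -- `v (π * ρ)`, which is `ℓ¹`-close to `v π`.
  have hpair : ∀ p ∈ (Finset.univ : Finset (Fin n)).offDiag,
      |S - ∑ π : Perm (Fin n), (a (π p.1) - a (π p.2)) ^ 2 * G (v π)| ≤ 32 * K * s * T := by
    intro p hp
    obtain ⟨ρ, h1, h2, h3⟩ := exists_perm_sum_perm_le a hij (by simpa using hp : p.1 ≠ p.2)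
    rw [hS, ← sum_perm_mul_right ρ, ← Finset.sum_sub_distrib]
    simp only [Perm.coe_mul, Function.comp_apply, h1, h2]
    rw [sum_perm_apply_eq (fun m => |a m| ^ 3) i m₀] at h3
    calc _ ≤ ∑ π : Perm (Fin n), K * s * ((a (π p.1) - a (π p.2)) ^ 2 *
            ∑ m, |a ((π * ρ) m) - a (π m)|) := by
          refine (Finset.abs_sum_le_sum_abs _ _).trans (Finset.sum_le_sum fun π _ => ?_)
          rw [← mul_sub, abs_mul, abs_of_nonneg (sq_nonneg _)]
          have := hK (v (π * ρ)) (v π)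
          have e : ∑ m, |v (π * ρ) m - v π m| = s * ∑ m, |a ((π * ρ) m) - a (π m)| := by
            rw [Finset.mul_sum]
            refine Finset.sum_congr rfl fun m _ => ?_
            rw [show v (π * ρ) m - v π m = s * (a ((π * ρ) m) - a (π m)) by simp only [hv]; ring,
              abs_mul, abs_of_nonneg hs]
          rw [e] at this
          refine (mul_le_mul_of_nonneg_left this (sq_nonneg _)).trans (le_of_eq ?_)
          ring
      _ ≤ K * s * (32 * T) := by
          rw [← Finset.mul_sum]
          exact mul_le_mul_of_nonneg_left h3 (mul_nonneg hK0 hs)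
      _ = _ := by ring
  have hsum : ∑ p ∈ (Finset.univ : Finset (Fin n)).offDiag,
      (S - ∑ π : Perm (Fin n), (a (π p.1) - a (π p.2)) ^ 2 * G (v π)) =
      ((n : ℝ) * n - n) * S - 2 * n * (n * q) * ∑ π : Perm (Fin n), G (v π) := by
    rw [Finset.sum_sub_distrib, Finset.sum_const, nsmul_eq_mul, cast_card_offDiag,
      Finset.sum_comm, Finset.mul_sum _ _ (2 * n * (n * q))]
    congr 1
    refine Finset.sum_congr rfl fun π _ => ?_
    rw [← Finset.sum_mul, sum_offDiag_eq (fun k l => (a (π k) - a (π l)) ^ 2) (by simp),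
      sum_sub_sq (fun k => a (π k)) ((Equiv.sum_comp π a).trans ha),
      Equiv.sum_comp π (fun k => a k ^ 2), hq]
  have hle := (Finset.abs_sum_le_sum_abs _ _).trans (Finset.sum_le_sum hpair)
  rw [hsum, Finset.sum_const, nsmul_eq_mul, cast_card_offDiag] at hle
  have hG : |∑ π : Perm (Fin n), G (v π)| ≤ Fintype.card (Perm (Fin n)) * M := by
    refine (Finset.abs_sum_le_sum_abs _ _).trans ?_
    refine (Finset.sum_le_sum fun π _ => hM (v π)).trans ?_
    simp
  have hc : (0 : ℝ) ≤ (n : ℝ) * n - n := by rw [← cast_card_offDiag]; positivity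
  have hexp : ∑ π : Perm (Fin n), ((a (π i) - a (π j)) ^ 2 - 2 * q) * G (v π) =
      S - 2 * q * ∑ π : Perm (Fin n), G (v π) := by
    simp only [sub_mul, Finset.sum_sub_distrib, Finset.mul_sum, hS]
  rw [hexp, ← abs_of_nonneg hc, ← abs_mul, abs_of_nonneg hc]
  -- The off-diagonal squares total `2n²q`, whereas `n² - n` copies of `2q` fall short of this by
  -- `2nq`; the `M` term comes from this mismatch.
  have e : ((n : ℝ) * n - n) * (S - 2 * q * ∑ π : Perm (Fin n), G (v π)) =
      (((n : ℝ) * n - n) * S - 2 * n * (n * q) * ∑ π : Perm (Fin n), G (v π)) +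
        2 * n * q * ∑ π : Perm (Fin n), G (v π) := by ring
  rw [e]
  refine (abs_add_le _ _).trans (add_le_add hle ?_)
  rw [abs_mul, abs_of_nonneg (by positivity : (0 : ℝ) ≤ 2 * n * q)]
  refine (mul_le_mul_of_nonneg_left hG (by positivity)).trans (le_of_eq (by ring))

/-- Approximate integration by parts for a uniformly random permutation of a centred vector. -/
lemma abs_sum_perm_integration_by_parts_le [NeZero n] {g : (Fin n → ℝ) → ℝ} (hg : ContDiff ℝ 3 g)
    {L₂ L₃ : ℝ} (hL₂ : IsPartialDerivBound 2 g L₂) (hL₃ : IsPartialDerivBound 3 g L₃)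
    {a : Fin n → ℝ} (ha : ∑ i, a i = 0) {q : ℝ} (hq0 : 0 ≤ q) (hq : n * q = ∑ i, a i ^ 2)
    (w : Fin n → ℝ) {s : ℝ} (hs : 0 ≤ s) :
    |∑ π : Perm (Fin n), (∑ i, a (π i) * partialDeriv i g (fun m => w m + s * a (π m)) -
      s * q / (2 * n) * ∑ i, ∑ j,
        diffDeriv i j (diffDeriv i j g) (fun m => w m + s * a (π m)))| ≤
      Fintype.card (Perm (Fin n)) *
        (2 * s * q * L₂ + 36 * s ^ 2 * (∑ i, |a i| ^ 3) * L₃) := by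
  set N := ((Fintype.card (Perm (Fin n)) : ℕ) : ℝ) with hN
  set A := ∑ i, |a i| ^ 3 with hA
  have hA0 : 0 ≤ A := Finset.sum_nonneg fun i _ => by positivity
  have hL₂0 := hL₂.nonneg
  have hL₃0 := hL₃.nonneg
  have hn : (0 : ℝ) < n := by exact_mod_cast Nat.pos_of_ne_zero (NeZero.ne n)
  set v : Perm (Fin n) → Fin n → ℝ := fun π m => w m + s * a (π m) with hv
  set T := ∑ π : Perm (Fin n), |a (π 0)| ^ 3 with hT
  have hT0 : 0 ≤ T := Finset.sum_nonneg fun i _ => by positivity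
  have hTA : n * T = N * A := card_mul_sum_perm_apply (fun m => |a m| ^ 3) 0
  set E : Fin n → Fin n → ℝ := fun i j =>
    ∑ π : Perm (Fin n), (a (π i) - a (π j)) * diffDeriv i j g (v π) -
      s / 2 * ∑ π : Perm (Fin n), (a (π i) - a (π j)) ^ 2 *
        diffDeriv i j (diffDeriv i j g) (v π) with hE
  set B : Fin n → Fin n → ℝ := fun i j => ∑ π : Perm (Fin n),
    ((a (π i) - a (π j)) ^ 2 - 2 * q) * diffDeriv i j (diffDeriv i j g) (v π) with hB
  have hdiag : ∀ i, B i i = 0 := by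
    intro i
    have : ∀ x, diffDeriv i i (diffDeriv i i g) x = 0 := fun x => sub_self _
    simp [hB, this]
  -- Errors per pair: `E` is the Taylor remainder of the transposition step, `B` the cost of
  -- replacing the squared increment by `2q`.
  have hid : 2 * n * ∑ π : Perm (Fin n), (∑ i, a (π i) * partialDeriv i g (v π) -
      s * q / (2 * n) * ∑ i, ∑ j, diffDeriv i j (diffDeriv i j g) (v π)) =
      ∑ i, ∑ j, E i j + s / 2 * ∑ i, ∑ j, B i j := by
    have h1 : ∀ i j, E i j + s / 2 * B i j = ∑ π : Perm (Fin n),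
        ((a (π i) - a (π j)) * (partialDeriv i g (v π) - partialDeriv j g (v π)) -
          s * q * diffDeriv i j (diffDeriv i j g) (v π)) := by
      intro i j
      simp only [hE, hB, Finset.mul_sum]
      rw [← Finset.sum_sub_distrib, ← Finset.sum_add_distrib]
      refine Finset.sum_congr rfl fun π _ => ?_
      change _ = (a (π i) - a (π j)) * diffDeriv i j g (v π) - _
      ring
    simp only [Finset.mul_sum, ← Finset.sum_add_distrib]
    simp only [← Finset.mul_sum, h1]
    rw [Finset.sum_congr rfl fun i _ => Finset.sum_comm, Finset.sum_comm, Finset.mul_sum]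
    refine Finset.sum_congr rfl fun π _ => ?_
    simp only [Finset.sum_sub_distrib, ← Finset.mul_sum]
    rw [sum_sub_mul_sub (fun i => a (π i)) (fun i => partialDeriv i g (v π))
      ((Equiv.sum_comp π a).trans ha)]
    field_simp
  have hg2 : ∀ i j, ContDiff ℝ 2 (diffDeriv i j g) := fun i j =>
    contDiff_diffDeriv (k := 2) (by exact_mod_cast hg) i j
  have hg1 : ∀ i j, ContDiff ℝ 1 (diffDeriv i j (diffDeriv i j g)) := fun i j => by
    exact_mod_cast contDiff_diffDeriv (k := 1) (by exact_mod_cast hg2 i j) i j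
  have hEsum : |∑ i, ∑ j, E i j| ≤ 8 * n * L₃ * s ^ 2 * N * A := by
    calc _ ≤ ∑ i, ∑ j, 2 * L₃ * s ^ 2 * ∑ π : Perm (Fin n), |a (π i) - a (π j)| ^ 3 := by
          refine (Finset.abs_sum_le_sum_abs _ _).trans (Finset.sum_le_sum fun i _ => ?_)
          refine (Finset.abs_sum_le_sum_abs _ _).trans (Finset.sum_le_sum fun j _ => ?_)
          exact abs_sum_perm_sub_mul_diffDeriv_le hg hL₃ a w s i j
      _ = 2 * L₃ * s ^ 2 * ∑ π : Perm (Fin n), ∑ i, ∑ j, |a (π i) - a (π j)| ^ 3 := by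
          simp only [← Finset.mul_sum]
          rw [Finset.sum_congr rfl fun i _ => Finset.sum_comm, Finset.sum_comm]
      _ ≤ 2 * L₃ * s ^ 2 * ∑ π : Perm (Fin n), 4 * n * A := by
          refine mul_le_mul_of_nonneg_left (Finset.sum_le_sum fun π _ => ?_) (by positivity)
          have := sum_abs_sub_pow_three_le (fun i => a (π i)) ((Equiv.sum_comp π a).trans ha)
          rwa [Equiv.sum_comp π fun i => |a i| ^ 3] at this
      _ = _ := by rw [Finset.sum_const, nsmul_eq_mul, Finset.card_univ]; ring
  have hBsum : |∑ i, ∑ j, B i j| ≤ 128 * n * s * L₃ * N * A + 8 * n * q * L₂ * N := by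
    rw [← sum_offDiag_eq B hdiag]
    refine (Finset.abs_sum_le_sum_abs _ _).trans ?_
    -- With no off-diagonal pair (`n = 1`) one cannot divide by `n² - n`, but then the sum is empty.
    rcases (Finset.univ : Finset (Fin n)).offDiag.eq_empty_or_nonempty with h0 | hne
    · rw [h0, Finset.sum_empty]; positivity
    have hc : (0 : ℝ) < (n : ℝ) * n - n := by
      rw [← cast_card_offDiag]; exact_mod_cast hne.card_pos
    refine le_of_mul_le_mul_left ?_ hc
    rw [Finset.mul_sum, ← cast_card_offDiag, ← nsmul_eq_mul, ← Finset.sum_const]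
    refine Finset.sum_le_sum fun p hp => ?_
    rw [cast_card_offDiag]
    have hp' : p.1 ≠ p.2 := by simpa using hp
    have b2 := (hL₂.diffDeriv (hg.of_le (by norm_num)) p.1 p.2).diffDeriv
      (r := 0) ((hg2 p.1 p.2).of_le (by norm_num)) p.1 p.2
    have b3 := (hL₃.diffDeriv (by exact_mod_cast hg) p.1 p.2).diffDeriv
      (r := 1) (by exact_mod_cast (hg2 p.1 p.2)) p.1 p.2
    have := mul_abs_sum_perm_sq_sub_mul_le ha hq0 hq b2.abs_le (by positivity)
      (b3.abs_sub_le (hg1 p.1 p.2)) w hs hp' 0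
    refine this.trans ?_
    have e : ((n : ℝ) * n - n) * (32 * (2 * (2 * L₃)) * s * T) =
        128 * s * L₃ * (n - 1) * (n * T) := by ring
    rw [e, hTA]
    have : 0 ≤ 128 * s * L₃ * (N * A) := by positivity
    nlinarith
  have hfin : |2 * n * ∑ π : Perm (Fin n), (∑ i, a (π i) * partialDeriv i g (v π) -
      s * q / (2 * n) * ∑ i, ∑ j, diffDeriv i j (diffDeriv i j g) (v π))| ≤
      2 * n * (N * (2 * s * q * L₂ + 36 * s ^ 2 * A * L₃)) := by
    rw [hid]
    refine (abs_add_le _ _).trans ?_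
    rw [abs_mul, abs_of_nonneg (by positivity : 0 ≤ s / 2)]
    have := mul_le_mul_of_nonneg_left hBsum (by positivity : 0 ≤ s / 2)
    linarith
  rw [abs_mul, abs_of_pos (by positivity : (0 : ℝ) < 2 * n)] at hfin
  exact le_of_mul_le_mul_left hfin (by positivity)

end PermutationAverages

/-! ### The trigonometric path from the surrogate to a permuted vector. -/

section Interpolation

open Equiv

variable {n : ℕ}

lemma continuous_empMean : Continuous (empMean : (Fin n → ℝ) → ℝ) := by
  unfold empMean; fun_prop

lemma empMean_add_smul_single (z : Fin n → ℝ) (t : ℝ) (k : Fin n) :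
    empMean (z + t • Pi.single k 1) = empMean z + t * (1 / (n : ℝ)) := by
  simp only [empMean, Pi.add_apply, Pi.smul_apply, smul_eq_mul, Finset.sum_add_distrib,
    ← Finset.mul_sum, Finset.sum_pi_single', Finset.mem_univ, if_true]
  ring

lemma integrable_empMean_stdGaussianLaw : Integrable (empMean (n := n)) (stdGaussianLaw n) := by
  unfold empMean
  exact (integrable_finsetSum _ fun i _ => integrable_eval_stdGaussianLaw i).const_mul _

lemma partialDeriv_comp_centering {h : (Fin n → ℝ) → ℝ} (hh : ContDiff ℝ 1 h) (b : Fin n → ℝ)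
    (r : ℝ) (k : Fin n) (z : Fin n → ℝ) :
    partialDeriv k (fun z => h fun m => b m + r * (z m - empMean z)) z =
      r * (partialDeriv k h (fun m => b m + r * (z m - empMean z)) -
        1 / n * ∑ l, partialDeriv l h (fun m => b m + r * (z m - empMean z))) := by
  have := hasDerivAt_comp_curve hh
    (c := fun t m => b m + r * ((z + t • (Pi.single k 1 : Fin n → ℝ)) m -
      empMean (z + t • Pi.single k 1)))
    (c' := fun m => r * ((Pi.single k 1 : Fin n → ℝ) m - 1 / n)) (t := 0) (fun m => by
      simp only [empMean_add_smul_single, Pi.add_apply, Pi.smul_apply, smul_eq_mul]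
      have h1 := ((hasDerivAt_id' (0 : ℝ)).mul_const ((Pi.single k 1 : Fin n → ℝ) m)).const_add
        (z m)
      have h2 := ((hasDerivAt_id' (0 : ℝ)).mul_const (1 / (n : ℝ))).const_add (empMean z)
      simpa using ((h1.sub h2).const_mul r).const_add (b m))
  unfold partialDeriv lineDeriv at this ⊢
  rw [this.deriv]
  simp only [zero_smul, add_zero, mul_sub, sub_mul, Finset.sum_sub_distrib, mul_assoc,
    ← Finset.mul_sum, Pi.single_apply, ite_mul, one_mul, zero_mul, Finset.sum_ite_eq',
    Finset.mem_univ, if_true]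

/-- Gaussian integration by parts for the centred standard Gaussian vector. -/
lemma integral_centered_mul_partialDeriv [NeZero n] {f : (Fin n → ℝ) → ℝ} (hf : ContDiff ℝ 2 f)
    {L₁ L₂ : ℝ} (hL₁ : IsPartialDerivBound 1 f L₁) (hL₂ : IsPartialDerivBound 2 f L₂)
    (b : Fin n → ℝ) (r : ℝ) :
    ∫ z, ∑ m, (z m - empMean z) * partialDeriv m f (fun m => b m + r * (z m - empMean z))
        ∂stdGaussianLaw n =
      ∫ z, r / (2 * n) * ∑ i, ∑ j, diffDeriv i j (diffDeriv i j f)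
        (fun m => b m + r * (z m - empMean z)) ∂stdGaussianLaw n := by
  have hn : (n : ℝ) ≠ 0 := Nat.cast_ne_zero.2 (NeZero.ne n)
  set v : (Fin n → ℝ) → Fin n → ℝ := fun z m => b m + r * (z m - empMean z) with hv
  have hvs : ContDiff ℝ 1 v := by
    rw [contDiff_pi]; intro m; unfold v empMean; fun_prop
  have hp : ∀ m, ContDiff ℝ 1 (partialDeriv m f) := fun m => by
    exact_mod_cast contDiff_partialDeriv (k := 1) (by exact_mod_cast hf) m
  have hpp : ∀ k m, Continuous (partialDeriv k (partialDeriv m f)) := fun k m =>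
    (contDiff_partialDeriv (k := 0) (by exact_mod_cast hp m) k).continuous
  have hpd : ∀ k m z, partialDeriv k (fun z => partialDeriv m f (v z)) z =
      r * (partialDeriv k (partialDeriv m f) (v z) -
        1 / n * ∑ l, partialDeriv l (partialDeriv m f) (v z)) :=
    fun k m z => partialDeriv_comp_centering (hp m) b r k z
  have hbd : ∀ k m z, |partialDeriv k (fun z => partialDeriv m f (v z)) z| ≤
      |r| * (L₂ + 1 / n * ∑ _l : Fin n, L₂) := by
    intro k m z
    have hk := fun k => (hL₂.partialDeriv m).abs_partialDeriv_le k (v z)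
    rw [hpd, abs_mul]
    refine mul_le_mul_of_nonneg_left ((abs_sub _ _).trans (add_le_add (hk k) ?_)) (abs_nonneg r)
    rw [abs_mul, abs_of_nonneg (by positivity : (0 : ℝ) ≤ 1 / n)]
    exact mul_le_mul_of_nonneg_left
      ((Finset.abs_sum_le_sum_abs _ _).trans (Finset.sum_le_sum fun l _ => hk l)) (by positivity)
  have hibp : ∀ k m, ∫ z, z k * partialDeriv m f (v z) ∂stdGaussianLaw n =
      ∫ z, partialDeriv k (fun z => partialDeriv m f (v z)) z ∂stdGaussianLaw n := fun k m =>
    integral_eval_mul_stdGaussianLaw ((hp m).comp hvs) k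
      (fun z => hL₁.abs_partialDeriv_le m (v z)) (hbd k m)
  have i1 : ∀ k m, Integrable (fun z => z k * partialDeriv m f (v z)) (stdGaussianLaw n) :=
    fun k m => (integrable_eval_stdGaussianLaw k).mul_bdd (c := L₁)
      ((hp m).continuous.comp hvs.continuous).aestronglyMeasurable
      (Filter.Eventually.of_forall fun z => hL₁.abs_partialDeriv_le m (v z))
  have i2 : ∀ k m, Integrable (partialDeriv k (fun z => partialDeriv m f (v z)))
      (stdGaussianLaw n) := fun k m =>
    Integrable.of_bound
      (contDiff_partialDeriv (k := 0) (by exact_mod_cast (hp m).comp hvs) k).continuous.aestronglyMeasurable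
      _ (Filter.Eventually.of_forall (hbd k m))
  have e1 : ∀ z : Fin n → ℝ, ∑ m, (z m - empMean z) * partialDeriv m f (v z) =
      ∑ m, (z m * partialDeriv m f (v z) - 1 / n * ∑ k, z k * partialDeriv m f (v z)) := by
    intro z
    refine Finset.sum_congr rfl fun m _ => ?_
    rw [empMean, ← Finset.sum_mul]; ring
  -- The Hessian traced against `I - 11ᵀ/n` is `1/(2n)` times `∑_{i,j} (∂_i - ∂_j)²`. Renaming
  -- indices suffices; symmetry of mixed partials is not needed.
  have e2 : ∀ z : Fin n → ℝ, r / (2 * n) * ∑ i, ∑ j, diffDeriv i j (diffDeriv i j f) (v z) =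
      ∑ m, (partialDeriv m (fun z => partialDeriv m f (v z)) z -
        1 / n * ∑ k, partialDeriv k (fun z => partialDeriv m f (v z)) z) := by
    intro z
    have hdd : ∀ i j, diffDeriv i j (diffDeriv i j f) (v z) =
        partialDeriv i (partialDeriv i f) (v z) - partialDeriv i (partialDeriv j f) (v z) -
          (partialDeriv j (partialDeriv i f) (v z) - partialDeriv j (partialDeriv j f) (v z)) := by
      intro i j
      unfold diffDeriv
      rw [partialDeriv_sub (hp i) (hp j), partialDeriv_sub (hp i) (hp j)]
    simp only [hdd, hpd, Finset.sum_sub_distrib, ← Finset.mul_sum, Finset.sum_const,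
      Finset.card_univ, Fintype.card_fin, nsmul_eq_mul]
    rw [Finset.sum_comm (f := fun i j => partialDeriv j (partialDeriv i f) (v z))]
    field_simp
    ring
  have i1' := fun m => (integrable_finsetSum Finset.univ fun k _ => i1 k m).const_mul (1 / (n : ℝ))
  have i2' := fun m => (integrable_finsetSum Finset.univ fun k _ => i2 k m).const_mul (1 / (n : ℝ))
  refine (integral_congr_ae (Filter.Eventually.of_forall e1)).trans
    (Eq.trans ?_ (integral_congr_ae (Filter.Eventually.of_forall e2)).symm)
  refine (integral_finsetSum _ fun m _ => (i1 m m).sub (i1' m)).trans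
    (Eq.trans ?_ (integral_finsetSum _ fun m _ => (i2 m m).sub (i2' m)).symm)
  refine Finset.sum_congr rfl fun m _ => ?_
  refine (integral_sub (i1 m m) (i1' m)).trans (Eq.trans ?_ (integral_sub (i2 m m) (i2' m)).symm)
  rw [integral_const_mul, integral_const_mul, integral_finsetSum _ fun k _ => i1 k m,
    integral_finsetSum _ fun k _ => i2 k m, hibp m m, Finset.sum_congr rfl fun k _ => hibp k m]

/-- A point of the path from the surrogate to a permuted vector. -/
noncomputable def interpolant (μ σ : ℝ) (a : Fin n → ℝ) (θ : ℝ) (z : Fin n → ℝ) : Fin n → ℝ :=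
  fun m => μ + Real.cos θ * σ * (z m - empMean z) + Real.sin θ * a m

/-- Differentiation under the integral: as `|sin|, |cos| ≤ 1`, one integrable dominating function
serves for all `θ`. Here `L₁` ensures integrability; it does not enter the final estimate. -/
lemma hasDerivAt_integral_interpolant [NeZero n] {f : (Fin n → ℝ) → ℝ} (hf : ContDiff ℝ 1 f)
    {L₁ : ℝ} (hL₁ : IsPartialDerivBound 1 f L₁) (μ σ : ℝ) (a : Fin n → ℝ) (θ : ℝ) :
    HasDerivAt (fun θ => ∫ z, f (interpolant μ σ a θ z) ∂stdGaussianLaw n)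
      (∫ z, ∑ m, (-Real.sin θ * σ * (z m - empMean z) + Real.cos θ * a m) *
        partialDeriv m f (interpolant μ σ a θ z) ∂stdGaussianLaw n) θ := by
  have hcont : ∀ θ, Continuous (interpolant μ σ a θ) := by
    intro θ; unfold interpolant empMean; fun_prop
  have hpc : ∀ m, Continuous (partialDeriv m f) := fun m =>
    (contDiff_partialDeriv (k := 0) (by exact_mod_cast hf) m).continuous
  have hW : ∀ m, Integrable (fun z : Fin n → ℝ => |σ| * |z m - empMean z| + |a m|)
      (stdGaussianLaw n) := fun m =>
    (((integrable_eval_stdGaussianLaw m).sub integrable_empMean_stdGaussianLaw).abs.const_mul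
      |σ|).add (integrable_const _)
  have hfac : ∀ (p c w y : ℝ), |p| ≤ 1 → |c| ≤ 1 → |p * σ * w + c * y| ≤ |σ| * |w| + |y| := by
    intro p c w y hp hc
    refine (abs_add_le _ _).trans (add_le_add ?_ ?_)
    · rw [abs_mul, abs_mul, mul_assoc]
      exact mul_le_of_le_one_left (by positivity) hp
    · rw [abs_mul]
      exact mul_le_of_le_one_left (abs_nonneg _) hc
  refine (hasDerivAt_integral_of_dominated_loc_of_deriv_le (s := Set.univ)
    (bound := fun z => ∑ m, (|σ| * |z m - empMean z| + |a m|) * L₁)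
    (F := fun θ z => f (interpolant μ σ a θ z))
    (F' := fun θ z => ∑ m, (-Real.sin θ * σ * (z m - empMean z) + Real.cos θ * a m) *
        partialDeriv m f (interpolant μ σ a θ z))
    Filter.univ_mem ?_ ?_ ?_ ?_ ?_ ?_).2
  · exact Filter.Eventually.of_forall fun θ =>
      (hf.continuous.comp (hcont θ)).aestronglyMeasurable
  · refine Integrable.mono' (g := fun z => |f fun _ => μ| +
      L₁ * ∑ m, (|σ| * |z m - empMean z| + |a m|)) ?_
      (hf.continuous.comp (hcont θ)).aestronglyMeasurable (Filter.Eventually.of_forall fun z => ?_)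
    · exact (integrable_const _).add ((integrable_finsetSum _ fun m _ => hW m).const_mul _)
    · have h1 := hL₁.abs_sub_le hf (interpolant μ σ a θ z) fun _ => μ
      have h2 : ∑ m, |interpolant μ σ a θ z m - μ| ≤ ∑ m, (|σ| * |z m - empMean z| + |a m|) := by
        refine Finset.sum_le_sum fun m _ => ?_
        rw [show interpolant μ σ a θ z m - μ =
          Real.cos θ * σ * (z m - empMean z) + Real.sin θ * a m by unfold interpolant; ring]
        exact hfac _ _ _ _ (Real.abs_cos_le_one θ) (Real.abs_sin_le_one θ)
      have h3 := mul_le_mul_of_nonneg_left h2 hL₁.nonneg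
      have h4 := abs_sub_abs_le_abs_sub (f (interpolant μ σ a θ z)) (f fun _ => μ)
      rw [Real.norm_eq_abs]
      linarith
  · have : Continuous fun z : Fin n → ℝ =>
        ∑ m, (-Real.sin θ * σ * (z m - empMean z) + Real.cos θ * a m) *
          partialDeriv m f (interpolant μ σ a θ z) := by
      refine continuous_finsetSum _ fun m _ => Continuous.mul ?_ ((hpc m).comp (hcont θ))
      unfold empMean; fun_prop
    exact this.aestronglyMeasurable
  · refine Filter.Eventually.of_forall fun z θ _ => ?_
    refine (norm_sum_le _ _).trans (Finset.sum_le_sum fun m _ => ?_)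
    rw [norm_mul]
    exact mul_le_mul (hfac _ _ _ _ (by rw [abs_neg]; exact Real.abs_sin_le_one θ)
      (Real.abs_cos_le_one θ)) (hL₁.abs_partialDeriv_le m _) (abs_nonneg _) (by positivity)
  · exact integrable_finsetSum _ fun m _ => (hW m).mul_const _
  · refine Filter.Eventually.of_forall fun z θ _ => ?_
    refine hasDerivAt_comp_curve hf (c := fun θ => interpolant μ σ a θ z) fun m => ?_
    unfold interpolant
    exact ((((Real.hasDerivAt_cos θ).mul_const σ).mul_const (z m - empMean z)).const_add μ).add
      ((Real.hasDerivAt_sin θ).mul_const (a m))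

/-- Comparison of a randomly permuted vector with the Gaussian vector of the same empirical mean
and standard deviation. -/
lemma abs_sum_perm_sub_integral_surrogate_le [NeZero n] {f : (Fin n → ℝ) → ℝ}
    (hf : ContDiff ℝ 3 f) {L₁ L₂ L₃ : ℝ} (hL₁ : IsPartialDerivBound 1 f L₁)
    (hL₂ : IsPartialDerivBound 2 f L₂) (hL₃ : IsPartialDerivBound 3 f L₃) (x : Fin n → ℝ) :
    |∑ π : Perm (Fin n), f (fun m => x (π m)) - Fintype.card (Perm (Fin n)) *
        ∫ z, f (surrogate x z) ∂stdGaussianLaw n| ≤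
      Fintype.card (Perm (Fin n)) *
        (empStd x ^ 2 * L₂ + 12 * (∑ i, |x i - empMean x| ^ 3) * L₃) := by
  have hn : (n : ℝ) ≠ 0 := Nat.cast_ne_zero.2 (NeZero.ne n)
  set N := ((Fintype.card (Perm (Fin n)) : ℕ) : ℝ) with hN
  set μ := empMean x with hμ
  set σ := empStd x with hσ
  set a : Fin n → ℝ := fun i => x i - μ with ha
  have ha0 : ∑ i, a i = 0 := by
    simp only [ha, hμ, empMean, Finset.sum_sub_distrib, Finset.sum_const, Finset.card_univ,
      Fintype.card_fin, nsmul_eq_mul]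
    field_simp
    ring
  have hq : n * σ ^ 2 = ∑ i, a i ^ 2 := by
    rw [hσ, empStd, Real.sq_sqrt (by positivity)]
    field_simp
    rfl
  set A := ∑ i, |a i| ^ 3 with hA
  have hp : ∀ m, ContDiff ℝ 2 (partialDeriv m f) := fun m => by
    exact_mod_cast contDiff_partialDeriv (k := 2) (by exact_mod_cast hf) m
  have hdd : ∀ i j, Continuous (diffDeriv i j (diffDeriv i j f)) := fun i j =>
    (contDiff_diffDeriv (k := 1)
      (contDiff_diffDeriv (k := 2) (by exact_mod_cast hf) i j) i j).continuous
  have hddb : ∀ i j x, |diffDeriv i j (diffDeriv i j f) x| ≤ 2 * (2 * L₂) := fun i j =>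
    ((hL₂.diffDeriv (hf.of_le (by norm_num)) i j).diffDeriv (r := 0)
      ((contDiff_diffDeriv (k := 2) (by exact_mod_cast hf) i j).of_le (by norm_num)) i j).abs_le
  have hcont : ∀ b θ, Continuous (interpolant (n := n) μ σ b θ) := by
    intro b θ; unfold interpolant empMean; fun_prop
  set v : Perm (Fin n) → ℝ → (Fin n → ℝ) → Fin n → ℝ :=
    fun π θ z => interpolant μ σ (fun m => a (π m)) θ z with hv
  set φ : ℝ → ℝ := fun θ => ∑ π : Perm (Fin n), ∫ z, f (v π θ z) ∂stdGaussianLaw n with hφ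
  have hderiv : ∀ θ, HasDerivAt φ (Real.cos θ * ∫ z, ∑ π : Perm (Fin n),
      (∑ m, a (π m) * partialDeriv m f (v π θ z) - Real.sin θ * σ ^ 2 / (2 * n) *
        ∑ i, ∑ j, diffDeriv i j (diffDeriv i j f) (v π θ z)) ∂stdGaussianLaw n) θ := by
    intro θ
    refine (HasDerivAt.fun_sum fun π _ => hasDerivAt_integral_interpolant
      (hf.of_le (by norm_num)) hL₁ μ σ (fun m => a (π m)) θ).congr_deriv ?_
    have j0 : ∀ (π : Perm (Fin n)) m, Integrable (fun z => partialDeriv m f (v π θ z))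
        (stdGaussianLaw n) := fun π m =>
      Integrable.of_bound ((hp m).continuous.comp (hcont _ θ)).aestronglyMeasurable L₁
        (Filter.Eventually.of_forall fun z => hL₁.abs_partialDeriv_le m _)
    have j1 : ∀ π : Perm (Fin n), Integrable (fun z => ∑ m, a (π m) * partialDeriv m f (v π θ z))
        (stdGaussianLaw n) := fun π => integrable_finsetSum _ fun m _ => (j0 π m).const_mul _
    have j2 : ∀ π : Perm (Fin n), Integrable (fun z =>
        ∑ i, ∑ j, diffDeriv i j (diffDeriv i j f) (v π θ z)) (stdGaussianLaw n) := fun π =>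
      integrable_finsetSum _ fun i _ => integrable_finsetSum _ fun j _ =>
        Integrable.of_bound ((hdd i j).comp (hcont _ θ)).aestronglyMeasurable _
          (Filter.Eventually.of_forall fun z => hddb i j _)
    have j3 : ∀ π : Perm (Fin n), Integrable (fun z =>
        ∑ m, (z m - empMean z) * partialDeriv m f (v π θ z)) (stdGaussianLaw n) := fun π =>
      integrable_finsetSum _ fun m _ =>
        ((integrable_eval_stdGaussianLaw m).sub integrable_empMean_stdGaussianLaw).mul_bdd (c := L₁)
          ((hp m).continuous.comp (hcont _ θ)).aestronglyMeasurable
          (Filter.Eventually.of_forall fun z => hL₁.abs_partialDeriv_le m _)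
    have j4 : ∀ π : Perm (Fin n), Integrable (fun z => ∑ m, a (π m) * partialDeriv m f (v π θ z) -
        Real.sin θ * σ ^ 2 / (2 * n) * ∑ i, ∑ j, diffDeriv i j (diffDeriv i j f) (v π θ z))
        (stdGaussianLaw n) := fun π => (j1 π).sub ((j2 π).const_mul _)
    rw [integral_finsetSum _ fun π _ => j4 π, Finset.mul_sum]
    refine Finset.sum_congr rfl fun π _ => ?_
    rw [integral_sub (j1 π) ((j2 π).const_mul _), integral_const_mul]
    have hibp := integral_centered_mul_partialDeriv (hf.of_le (by norm_num)) hL₁ hL₂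
      (fun m => μ + Real.sin θ * a (π m)) (Real.cos θ * σ)
    have hve : ∀ z, (fun m => μ + Real.sin θ * a (π m) + Real.cos θ * σ * (z m - empMean z)) =
        v π θ z := fun z => by
      funext m; simp only [hv, interpolant]; ring
    simp only [hve] at hibp
    rw [integral_const_mul] at hibp
    have e : ∀ z : Fin n → ℝ,
        ∑ m, (-Real.sin θ * σ * (z m - empMean z) + Real.cos θ * a (π m)) *
          partialDeriv m f (interpolant μ σ (fun m => a (π m)) θ z) =
        Real.cos θ * ∑ m, a (π m) * partialDeriv m f (v π θ z) -
          Real.sin θ * σ * ∑ m, (z m - empMean z) * partialDeriv m f (v π θ z) := by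
      intro z
      rw [Finset.mul_sum, Finset.mul_sum, ← Finset.sum_sub_distrib]
      refine Finset.sum_congr rfl fun m _ => ?_
      simp only [hv]; ring
    simp only [e]
    rw [integral_sub ((j1 π).const_mul _) ((j3 π).const_mul _), integral_const_mul,
      integral_const_mul, hibp]
    ring
  -- The two terms are written as derivatives of `sin²` and `sin³`, so that `36` becomes `12` upon
  -- integration.
  have hbound : ∀ θ ∈ Set.Ico 0 (Real.pi / 2), ‖Real.cos θ * ∫ z, ∑ π : Perm (Fin n),
      (∑ m, a (π m) * partialDeriv m f (v π θ z) - Real.sin θ * σ ^ 2 / (2 * n) *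
        ∑ i, ∑ j, diffDeriv i j (diffDeriv i j f) (v π θ z)) ∂stdGaussianLaw n‖ ≤
      N * (σ ^ 2 * L₂ * (2 * Real.sin θ * Real.cos θ) +
        12 * A * L₃ * (3 * Real.sin θ ^ 2 * Real.cos θ)) := by
    intro θ hθ
    have hc : 0 ≤ Real.cos θ :=
      Real.cos_nonneg_of_neg_pi_div_two_le_of_le (by linarith [hθ.1, Real.pi_pos]) hθ.2.le
    have hs : 0 ≤ Real.sin θ :=
      Real.sin_nonneg_of_nonneg_of_le_pi hθ.1 (by linarith [hθ.2, Real.pi_pos])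
    have h0 : ∀ z : Fin n → ℝ, ‖∑ π : Perm (Fin n),
        (∑ m, a (π m) * partialDeriv m f (v π θ z) - Real.sin θ * σ ^ 2 / (2 * n) *
          ∑ i, ∑ j, diffDeriv i j (diffDeriv i j f) (v π θ z))‖ ≤
        N * (2 * Real.sin θ * σ ^ 2 * L₂ + 36 * Real.sin θ ^ 2 * A * L₃) := fun z =>
      abs_sum_perm_integration_by_parts_le hf hL₂ hL₃ ha0 (sq_nonneg σ) hq
        (fun m => μ + Real.cos θ * σ * (z m - empMean z)) hs
    have h1 := norm_integral_le_of_norm_le_const (μ := stdGaussianLaw n)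
      (Filter.Eventually.of_forall h0)
    rw [probReal_univ, mul_one] at h1
    rw [norm_mul, Real.norm_of_nonneg hc]
    refine (mul_le_mul_of_nonneg_left h1 hc).trans (le_of_eq ?_)
    ring
  have key := image_norm_le_of_norm_deriv_right_le_deriv_boundary (a := 0) (b := Real.pi / 2)
    (f := fun θ => φ θ - φ 0)
    (B := fun θ => N * (σ ^ 2 * L₂ * Real.sin θ ^ 2 + 12 * A * L₃ * Real.sin θ ^ 3))
    (fun θ _ => ((hderiv θ).sub_const (φ 0)).continuousAt.continuousWithinAt)
    (fun θ _ => ((hderiv θ).sub_const (φ 0)).hasDerivWithinAt) (by simp)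
    (fun θ => by
      have h2 := ((Real.hasDerivAt_sin θ).pow 2).const_mul (σ ^ 2 * L₂)
      have h3 := ((Real.hasDerivAt_sin θ).pow 3).const_mul (12 * A * L₃)
      refine ((h2.add h3).const_mul N).congr_deriv ?_
      norm_num)
    hbound (Set.right_mem_Icc.2 (by positivity))
  have h0 : φ 0 = N * ∫ z, f (surrogate x z) ∂stdGaussianLaw n := by
    have : ∀ π z, v π 0 z = surrogate x z := by
      intro π z; funext m; simp [hv, interpolant, surrogate, hμ, hσ]
    simp [hφ, this, hN]
  have h1 : φ (Real.pi / 2) = ∑ π : Perm (Fin n), f (fun m => x (π m)) := by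
    have : ∀ π z, v π (Real.pi / 2) z = fun m => x (π m) := by
      intro π z; funext m; simp [hv, interpolant, ha]
    simp [hφ, this]
  simpa [h0, h1] using key

end Interpolation

/-! ### Exchangeability, integrability and moments. -/

section RandomVectors

variable {Ω : Type*} [MeasurableSpace Ω] {P : Measure Ω} {n : ℕ} {X : Ω → Fin n → ℝ}

lemma empMean_comp_perm (x : Fin n → ℝ) (π : Equiv.Perm (Fin n)) :
    empMean (fun i => x (π i)) = empMean x := by
  unfold empMean; rw [Equiv.sum_comp π x]

lemma empStd_sq (x : Fin n → ℝ) : empStd x ^ 2 = 1 / n * ∑ i, (x i - empMean x) ^ 2 :=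
  Real.sq_sqrt (by positivity)

lemma continuous_empStd : Continuous (empStd : (Fin n → ℝ) → ℝ) := by
  unfold empStd empMean; fun_prop

lemma IsExchangeable.aemeasurable_perm (hX : IsExchangeable P X) (π : Equiv.Perm (Fin n)) :
    AEMeasurable (fun ω i => X ω (π i)) P :=
  (measurable_pi_lambda (fun (x : Fin n → ℝ) i => x (π i))
    fun i => measurable_pi_apply (π i)).comp_aemeasurable hX.1

lemma IsExchangeable.integral_perm (hX : IsExchangeable P X) (π : Equiv.Perm (Fin n))
    {F : (Fin n → ℝ) → ℝ} (hF : Continuous F) :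
    ∫ ω, F (fun i => X ω (π i)) ∂P = ∫ ω, F (X ω) ∂P := by
  rw [← integral_map hX.1 hF.aestronglyMeasurable, ← hX.2 π,
    integral_map (hX.aemeasurable_perm π) hF.aestronglyMeasurable]

lemma IsExchangeable.integrable_perm (hX : IsExchangeable P X) (π : Equiv.Perm (Fin n))
    {F : (Fin n → ℝ) → ℝ} (hF : Continuous F) (hi : Integrable (fun ω => F (X ω)) P) :
    Integrable (fun ω => F (fun i => X ω (π i))) P := by
  have h := (integrable_map_measure hF.aestronglyMeasurable hX.1).2 hi
  rw [← hX.2 π] at h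
  exact (integrable_map_measure hF.aestronglyMeasurable (hX.aemeasurable_perm π)).1 h

lemma IsExchangeable.integral_abs_sub_empMean_pow [NeZero n] (hX : IsExchangeable P X) (p : ℕ)
    (i : Fin n) : ∫ ω, |X ω i - empMean (X ω)| ^ p ∂P = centralMoment P X p := by
  have hF : Continuous fun x : Fin n → ℝ => |x 0 - empMean x| ^ p := by
    unfold empMean; fun_prop
  have := hX.integral_perm (Equiv.swap 0 i) hF
  simpa [empMean_comp_perm, centralMoment] using this

lemma memLp_empMean {p : ENNReal} (hX : ∀ i, MemLp (fun ω => X ω i) p P) :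
    MemLp (fun ω => empMean (X ω)) p P := by
  unfold empMean
  exact (memLp_finsetSum _ fun i _ => hX i).const_mul _

lemma memLp_empStd (hXm : AEMeasurable X P)
    (hX : ∀ i, MemLp (fun ω => X ω i) 2 P) : MemLp (fun ω => empStd (X ω)) 2 P := by
  refine (memLp_two_iff_integrable_sq
    (continuous_empStd.measurable.comp_aemeasurable hXm).aestronglyMeasurable).2 ?_
  change Integrable (fun ω => empStd (X ω) ^ 2) P
  simp only [empStd_sq]
  exact (integrable_finsetSum _ fun i _ => ((hX i).sub (memLp_empMean hX)).integrable_sq).const_mul _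

/-- A function with bounded first partial derivatives is integrable along an integrable vector. -/
lemma integrable_comp_of_isPartialDerivBound [NeZero n] [IsFiniteMeasure P]
    {f : (Fin n → ℝ) → ℝ} (hf : ContDiff ℝ 1 f) {L : ℝ} (hL : IsPartialDerivBound 1 f L)
    (hX : ∀ i, Integrable (fun ω => X ω i) P) : Integrable (fun ω => f (X ω)) P := by
  have hXm : AEMeasurable X P := aemeasurable_pi_lambda _ fun i => (hX i).aemeasurable
  refine Integrable.mono' (g := fun ω => |f 0| + L * ∑ i, |X ω i|)
    ((integrable_const _).add ((integrable_finsetSum _ fun i _ => (hX i).abs).const_mul L))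
    (hf.continuous.measurable.comp_aemeasurable hXm).aestronglyMeasurable
    (Filter.Eventually.of_forall fun ω => ?_)
  have h1 := hL.abs_sub_le hf (X ω) 0
  simp only [Pi.zero_apply, sub_zero] at h1
  have h2 := abs_sub_abs_le_abs_sub (f (X ω)) (f 0)
  rw [Real.norm_eq_abs]
  linarith

lemma continuous_surrogate :
    Continuous fun p : (Fin n → ℝ) × (Fin n → ℝ) => surrogate p.1 p.2 := by
  unfold surrogate
  have h1 := continuous_empMean (n := n)
  have h2 := continuous_empStd (n := n)
  fun_prop

/-- Independence makes the product of `empStd (X ω)` and the centred Gaussian coordinate integrable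
as soon as each factor is. -/
lemma integrable_surrogate [IsProbabilityMeasure P] {Z : Ω → Fin n → ℝ} (hXm : AEMeasurable X P)
    (hX : ∀ i, MemLp (fun ω => X ω i) 2 P) (hZ : HasLaw Z (stdGaussianLaw n) P)
    (hXZ : IndepFun X Z P) (i : Fin n) : Integrable (fun ω => surrogate (X ω) (Z ω) i) P := by
  have hZi : Integrable (fun ω => Z ω i - empMean (Z ω)) P := by
    have hz : Integrable (fun z : Fin n → ℝ => z i - empMean z) (stdGaussianLaw n) :=
      (integrable_eval_stdGaussianLaw i).sub integrable_empMean_stdGaussianLaw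
    rw [← hZ.map_eq] at hz
    exact hz.comp_aemeasurable hZ.aemeasurable
  have hind : IndepFun (fun ω => empStd (X ω)) (fun ω => Z ω i - empMean (Z ω)) P :=
    hXZ.comp continuous_empStd.measurable
      ((measurable_pi_apply i).sub continuous_empMean.measurable)
  exact ((memLp_empMean hX).integrable one_le_two).add
    (hind.integrable_mul ((memLp_empStd hXm hX).integrable one_le_two) hZi)

/-- Exchangeability gives `E σ̂² = m₂`, and `m₂² ≤ m₄` because the variance of `(X₁ - μ̂)²` is
nonnegative. -/
lemma IsExchangeable.integral_empStd_sq_le [NeZero n] [IsProbabilityMeasure P]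
    (hX : IsExchangeable P X) (hX4 : ∀ i, MemLp (fun ω => X ω i) 4 P) :
    ∫ ω, empStd (X ω) ^ 2 ∂P ≤ Real.sqrt (centralMoment P X 4) := by
  have hn : (n : ℝ) ≠ 0 := Nat.cast_ne_zero.2 (NeZero.ne n)
  have hD : ∀ i, MemLp (fun ω => X ω i - empMean (X ω)) 4 P := fun i =>
    (hX4 i).sub (memLp_empMean hX4)
  have hD2 : ∀ i, Integrable (fun ω => (X ω i - empMean (X ω)) ^ 2) P := fun i =>
    ((hD i).mono_exponent (by norm_num)).integrable_sq
  have hD4 : Integrable (fun ω => ((X ω 0 - empMean (X ω)) ^ 2) ^ 2) P := by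
    refine ((hD 0).integrable_norm_pow (p := 4) (by norm_num)).congr
      (Filter.Eventually.of_forall fun ω => ?_)
    change |X ω 0 - empMean (X ω)| ^ 4 = ((X ω 0 - empMean (X ω)) ^ 2) ^ 2
    rw [← sq_abs (X ω 0 - empMean (X ω))]; ring
  have h2 : ∫ ω, empStd (X ω) ^ 2 ∂P = ∫ ω, (X ω 0 - empMean (X ω)) ^ 2 ∂P := by
    have : ∀ i, ∫ ω, (X ω i - empMean (X ω)) ^ 2 ∂P = centralMoment P X 2 := fun i => by
      simpa using hX.integral_abs_sub_empMean_pow 2 i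
    simp only [empStd_sq]
    rw [integral_const_mul, integral_finsetSum _ fun i _ => hD2 i]
    simp only [this, Finset.sum_const, Finset.card_univ, Fintype.card_fin, nsmul_eq_mul]
    field_simp
  have h4 : centralMoment P X 4 = ∫ ω, ((X ω 0 - empMean (X ω)) ^ 2) ^ 2 ∂P := by
    refine integral_congr_ae (Filter.Eventually.of_forall fun ω => ?_)
    beta_reduce
    rw [← sq_abs (X ω 0 - empMean (X ω))]; ring
  rw [h2, h4]
  refine Real.le_sqrt_of_sq_le ?_
  have hm : MemLp (fun ω => (X ω 0 - empMean (X ω)) ^ 2) 2 P :=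
    (memLp_two_iff_integrable_sq (hD2 0).aestronglyMeasurable).2 hD4
  have h := variance_nonneg (fun ω => (X ω 0 - empMean (X ω)) ^ 2) P
  rw [variance_eq_sub hm] at h
  exact sub_nonneg.1 h

end RandomVectors

end Exch

/-! ### From a fixed vector to the random vector. -/

theorem theorem1p2 {Ω : Type*} [MeasurableSpace Ω] (P : Measure Ω) [IsProbabilityMeasure P]
    (n : ℕ) [NeZero n] (X Z : Ω → Fin n → ℝ)
    (hX : Exch.IsExchangeable P X) (hX4 : ∀ i, MemLp (fun ω => X ω i) 4 P)
    (hZ : HasLaw Z (Exch.stdGaussianLaw n) P) (hXZ : IndepFun X Z P)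
    (f : (Fin n → ℝ) → ℝ) (hf : ContDiff ℝ 3 f) (L₁ L₂ L₃ : ℝ)
    (hL₁ : Exch.IsPartialDerivBound 1 f L₁)
    (hL₂ : Exch.IsPartialDerivBound 2 f L₂)
    (hL₃ : Exch.IsPartialDerivBound 3 f L₃) :
    Integrable (fun ω => f (X ω)) P ∧
    Integrable (fun ω => f (Exch.surrogate (X ω) (Z ω))) P ∧
    |(∫ ω, f (X ω) ∂P) - ∫ ω, f (Exch.surrogate (X ω) (Z ω)) ∂P| ≤
      9.5 * Real.sqrt (Exch.centralMoment P X 4) * L₂ * Real.sqrt n +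
        13 * Exch.centralMoment P X 3 * L₃ * n := by
  have hf1 : ContDiff ℝ 1 f := hf.of_le (by norm_num)
  have hX2 : ∀ i, MemLp (fun ω => X ω i) 2 P := fun i => (hX4 i).mono_exponent (by norm_num)
  have hX3 : ∀ i, MemLp (fun ω => X ω i) 3 P := fun i => (hX4 i).mono_exponent (by norm_num)
  have hfX : Integrable (fun ω => f (X ω)) P :=
    Exch.integrable_comp_of_isPartialDerivBound hf1 hL₁ fun i => (hX2 i).integrable one_le_two
  have hfY : Integrable (fun ω => f (Exch.surrogate (X ω) (Z ω))) P :=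
    Exch.integrable_comp_of_isPartialDerivBound hf1 hL₁
      (Exch.integrable_surrogate hX.1 hX2 hZ hXZ)
  refine ⟨hfX, hfY, ?_⟩
  set γ := Exch.stdGaussianLaw n with hγ
  set Φ : (Fin n → ℝ) → ℝ := fun x => ∫ z, f (Exch.surrogate x z) ∂γ with hΦ
  have hcont : Continuous fun p : (Fin n → ℝ) × (Fin n → ℝ) => f (Exch.surrogate p.1 p.2) :=
    hf.continuous.comp Exch.continuous_surrogate
  have hpair : AEMeasurable (fun ω => (X ω, Z ω)) P := hX.1.prodMk hZ.aemeasurable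
  have hmap : P.map (fun ω => (X ω, Z ω)) = (P.map X).prod γ := by
    rw [hXZ.map_prod_eq_prod_map_map hX.1 hZ.aemeasurable, hZ.map_eq]
  have : IsProbabilityMeasure (P.map X) := Measure.isProbabilityMeasure_map hX.1
  have hprod : Integrable (fun p : (Fin n → ℝ) × (Fin n → ℝ) => f (Exch.surrogate p.1 p.2))
      ((P.map X).prod γ) := by
    rw [← hmap]
    exact (integrable_map_measure hcont.aestronglyMeasurable hpair).2 hfY
  have hΦν : Integrable Φ (P.map X) := hprod.integral_prod_left
  have hΦi : Integrable (fun ω => Φ (X ω)) P := hΦν.comp_aemeasurable hX.1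
  -- Independence makes the joint law of `X` and `Z` a product, so Fubini integrates out `Z` first.
  have hYΦ : ∫ ω, f (Exch.surrogate (X ω) (Z ω)) ∂P = ∫ ω, Φ (X ω) ∂P := by
    rw [← integral_map hX.1 hΦν.aestronglyMeasurable, ← integral_prod _ hprod, ← hmap,
      integral_map hpair hcont.aestronglyMeasurable]
  set N := ((Fintype.card (Equiv.Perm (Fin n)) : ℕ) : ℝ) with hN
  have hN0 : 0 < N := by rw [hN]; exact_mod_cast Fintype.card_pos
  have hD3 : ∀ i, Integrable (fun ω => |X ω i - Exch.empMean (X ω)| ^ 3) P := fun i =>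
    ((hX3 i).sub (Exch.memLp_empMean hX3)).integrable_norm_pow (p := 3) (by norm_num)
  have hS2 : Integrable (fun ω => Exch.empStd (X ω) ^ 2) P :=
    (Exch.memLp_empStd hX.1 hX2).integrable_sq
  have hdiff : N * (∫ ω, f (X ω) ∂P - ∫ ω, f (Exch.surrogate (X ω) (Z ω)) ∂P) =
      ∫ ω, (∑ π : Equiv.Perm (Fin n), f (fun m => X ω (π m)) - N * Φ (X ω)) ∂P := by
    rw [integral_sub (integrable_finsetSum _ fun π _ => hX.integrable_perm π hf.continuous hfX)
      (hΦi.const_mul N), integral_const_mul,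
      integral_finsetSum _ fun π _ => hX.integrable_perm π hf.continuous hfX,
      Finset.sum_congr rfl fun π _ => hX.integral_perm π hf.continuous, hYΦ, Finset.sum_const,
      Finset.card_univ, nsmul_eq_mul, mul_sub]
  have hB3 := integrable_finsetSum Finset.univ fun i _ => hD3 i
  have hle : N * |∫ ω, f (X ω) ∂P - ∫ ω, f (Exch.surrogate (X ω) (Z ω)) ∂P| ≤
      N * ((∫ ω, Exch.empStd (X ω) ^ 2 ∂P) * L₂ +
        12 * (n * Exch.centralMoment P X 3) * L₃) := by
    rw [← abs_of_pos hN0, ← abs_mul, abs_of_pos hN0, hdiff]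
    have hbound : ∀ ω, ‖∑ π : Equiv.Perm (Fin n), f (fun m => X ω (π m)) - N * Φ (X ω)‖ ≤
        N * (Exch.empStd (X ω) ^ 2 * L₂ +
          12 * (∑ i, |X ω i - Exch.empMean (X ω)| ^ 3) * L₃) := fun ω =>
      Exch.abs_sum_perm_sub_integral_surrogate_le hf hL₁ hL₂ hL₃ (X ω)
    have hB := (hB3.const_mul 12).mul_const L₃
    refine (norm_integral_le_of_norm_le (((hS2.mul_const L₂).add hB).const_mul N)
      (Filter.Eventually.of_forall hbound)).trans (le_of_eq ?_)
    rw [integral_const_mul]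
    refine congrArg (N * ·) ((integral_add (hS2.mul_const L₂) hB).trans ?_)
    rw [integral_mul_const, integral_mul_const, integral_const_mul,
      integral_finsetSum _ fun i _ => hD3 i,
      Finset.sum_congr rfl fun i _ => hX.integral_abs_sub_empMean_pow 3 i]
    simp
  have h1 := le_of_mul_le_mul_left hle hN0
  have h2 := mul_le_mul_of_nonneg_right (hX.integral_empStd_sq_le hX4) hL₂.nonneg
  -- The estimate `h1` has constants `1` and `12` and no `√n`; it is weakened here to the stated
  -- form.
  have hn : 1 ≤ Real.sqrt n := by
    rw [Real.one_le_sqrt]; exact_mod_cast NeZero.one_le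
  have h3 : 0 ≤ Real.sqrt (Exch.centralMoment P X 4) * L₂ :=
    mul_nonneg (Real.sqrt_nonneg _) hL₂.nonneg
  have h4 := mul_le_mul_of_nonneg_left hn h3
  have h5 : 0 ≤ Exch.centralMoment P X 3 := integral_nonneg fun ω => by positivity
  have h6 : 0 ≤ n * Exch.centralMoment P X 3 * L₃ := by
    have := hL₃.nonneg
    positivity
  linarith
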